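/- Let $d\ge 0$, $t>1$, and let $\nu_0,\nu_1$ be Borel probability measures on $\mathbb{R}^d$ with finite second moments. Call a function $u:\mathbb{R}^d\to(-\infty,+\infty]$ \emph{admissible} if it is proper (not identically $+\infty$), lower semicontinuous, and $u-\frac{t-1}{t}\frac{|\cdot|^2}{2}$ is convex. Let $u^*(y)=\sup_{x}\{\langle x,y\rangle-u(x)\}$ be the Legendre transform of $u$, and consider the problem $$(\mathcal P^*)\qquad \inf\Big\{\int u^*\,\mathrm d\nu_1+\int u\,\mathrm d\nu_0 \;:\; u \text{ admissible}\Big\}.$$ Let $u$ be admissible. Then $u^*$ is finite and differentiable on $\mathbb{R}^d$ and $\nabla u^*$ is Lipschitz with constant $t/(t-1)$, so that the push-forward $\overline\nu_0:=(\nabla u^*)_\#\nu_1$ is well defined; put $\eta:=\overline\nu_0-\nu_0$. The function $u$ solves $(\mathcal P^*)$ if and only if $$\int\Big(u(x)-\frac{t-1}{t}\frac{|x|^2}{2}\Big)\,\mathrm d\eta(x)=0\qquad\text{and}\qquad \int\varphi\,\mathrm d\eta\le 0$$ for every lower semicontinuous convex function $\varphi:\mathbb{R}^d\to(-\infty,+\infty]$.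 Here $\int f\,\mathrm d\eta=\int f\,\mathrm d\overline\nu_0-\int f\,\mathrm d\nu_0$; the first condition means that both integrals are finite and equal, and the second one that $\int\varphi\,\mathrm d\overline\nu_0\le\int\varphi\,\mathrm d\nu_0$ in $(-\infty,+\infty]$. In particular, if $u$ solves $(\mathcal P^*)$, then $\overline\nu_0$ is dominated by $\nu_0$ in convex order: both are probability measures with finite first moment and $\int\varphi\,\mathrm d\overline\nu_0\le\int\varphi\,\mathrm d\nu_0$ in $(-\infty,+\infty]$ for every convex $\varphi:\mathbb{R}^d\to\mathbb{R}$. -/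

import Mathlib

open MeasureTheory

noncomputable section

namespace Extrapolation

/-- Integral of an extended-real function `f`, as the difference of the integrals of its
positive and negative parts. It takes its usual value in `(-∞, ∞]` whenever `f` is measurable
with an integrable negative part, as are all the functions integrated below. -/
def eintegral {α : Type*} [MeasurableSpace α] (f : α → EReal) (μ : Measure α) : EReal :=
  ((∫⁻ x, (f x).toENNReal ∂μ : ENNReal) : EReal) - ((∫⁻ x, (-f x).toENNReal ∂μ : ENNReal) : EReal)

/-- Integral of `f` against the signed measure `μ - ν`. Since `⊤ - ⊤ = ⊥` in `EReal`, the relation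
`eintegralDiff f μ ν = 0` says that both integrals are finite and equal, and
`eintegralDiff f μ ν ≤ 0` says that `∫ f dμ ≤ ∫ f dν` in the extended reals
(see the two lemmas that follow). -/
def eintegralDiff {α : Type*} [MeasurableSpace α] (f : α → EReal) (μ ν : Measure α) : EReal :=
  eintegral f μ - eintegral f ν

theorem eintegralDiff_eq_zero_iff {α : Type*} [MeasurableSpace α] (f : α → EReal)
    (μ ν : Measure α) :
    eintegralDiff f μ ν = 0 ↔ ∃ r : ℝ, eintegral f μ = (r : EReal) ∧ eintegral f ν = (r : EReal) := by
  unfold eintegralDiff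
  generalize eintegral f μ = a
  generalize eintegral f ν = b
  induction a <;> induction b <;> simp
  norm_cast
  rw [sub_eq_zero, eq_comm]

theorem eintegralDiff_nonpos_iff {α : Type*} [MeasurableSpace α] (f : α → EReal)
    (μ ν : Measure α) :
    eintegralDiff f μ ν ≤ 0 ↔ eintegral f μ ≤ eintegral f ν := by
  unfold eintegralDiff
  generalize eintegral f μ = a
  generalize eintegral f ν = b
  induction a <;> induction b <;> simp
  norm_cast
  rw [sub_nonpos]

/-- Convexity of a function with values in `(-∞, ∞]`. -/
def IsConvex {E : Type*} [AddCommGroup E] [Module ℝ E] (f : E → EReal) : Prop :=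
  (∀ x, f x ≠ ⊥) ∧
    ∀ x y : E, ∀ a b : ℝ, 0 < a → 0 < b → a + b = 1 →
      f (a • x + b • y) ≤ (a : EReal) * f x + (b : EReal) * f y

section Euclidean

variable {d : ℕ}

/-- The function `x ↦ u x - m |x|² / 2`. -/
def subQuadratic (m : ℝ) (u : EuclideanSpace ℝ (Fin d) → EReal) :
    EuclideanSpace ℝ (Fin d) → EReal :=
  fun x => u x - ((m * (‖x‖ ^ 2 / 2) : ℝ) : EReal)

/-- The admissible potentials: proper lower semicontinuous functions `u` with values in `(-∞, ∞]`
such that `u - ((t - 1) / t) |·|² / 2` is convex. -/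
structure IsAdmissible (t : ℝ) (u : EuclideanSpace ℝ (Fin d) → EReal) : Prop where
  ne_bot : ∀ x, u x ≠ ⊥
  exists_ne_top : ∃ x, u x ≠ ⊤
  lowerSemicontinuous : LowerSemicontinuous u
  convex : IsConvex (subQuadratic ((t - 1) / t) u)

/-- The Legendre transform `u*`. -/
def legendre (u : EuclideanSpace ℝ (Fin d) → EReal) : EuclideanSpace ℝ (Fin d) → EReal :=
  fun y => ⨆ x, (((inner ℝ x y : ℝ) : EReal) - u x)

/-- The gradient `∇u*` of the Legendre transform. -/
def gradLegendre (u : EuclideanSpace ℝ (Fin d) → EReal) :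
    EuclideanSpace ℝ (Fin d) → EuclideanSpace ℝ (Fin d) :=
  gradient fun y => (legendre u y).toReal

/-- The functional `u ↦ ∫ u* dν₁ + ∫ u dν₀`. -/
def dualObjective (ν₀ ν₁ : Measure (EuclideanSpace ℝ (Fin d)))
    (u : EuclideanSpace ℝ (Fin d) → EReal) : EReal :=
  eintegral (legendre u) ν₁ + eintegral u ν₀

/-- `u` minimizes `∫ u* dν₁ + ∫ u dν₀` among the admissible potentials. -/
def SolvesDual (t : ℝ) (ν₀ ν₁ : Measure (EuclideanSpace ℝ (Fin d)))
    (u : EuclideanSpace ℝ (Fin d) → EReal) : Prop :=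
  IsAdmissible t u ∧
    ∀ v : EuclideanSpace ℝ (Fin d) → EReal, IsAdmissible t v →
      dualObjective ν₀ ν₁ u ≤ dualObjective ν₀ ν₁ v

/-- `μ` is dominated by `ν` in convex order, for probability measures with finite first moment. -/
structure ConvexOrderLE (μ ν : Measure (EuclideanSpace ℝ (Fin d))) : Prop where
  isProbabilityMeasure_left : IsProbabilityMeasure μ
  isProbabilityMeasure_right : IsProbabilityMeasure ν
  integrable_left : Integrable (fun x => x) μ
  integrable_right : Integrable (fun x => x) ν
  le : ∀ φ : EuclideanSpace ℝ (Fin d) → ℝ, ConvexOn ℝ Set.univ φ →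
    eintegral (fun x => (φ x : EReal)) μ ≤ eintegral (fun x => (φ x : EReal)) ν

end Euclidean

end Extrapolation

end

noncomputable section

namespace Extrapolation

/-! ### Extended-real integrals of functions with an integrable minorant -/

section EIntegral

variable {α : Type*} [MeasurableSpace α] {μ : Measure α}

/-! Put m = (t-1)/t, q = m|·|²/2, g = u - q, P = u* and X = ∇u*. Since u is m-strongly convex, ⟨·,
y⟩ - u is maximal at X(y), and Fenchel's inequality gains a quadratic term: u(z) ≥ ⟨z, y⟩ - P(y) +
(m/2)|z - X(y)|², with equality at z = X(y). This estimate (`IsConjugate`) gives the regularity of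
u* and controls every perturbation of u to second order.

Necessity: for φ convex and Lipschitz, u + εφ is admissible and its transform is at most P - ε φ∘X +
O(ε²); optimality and ε → 0 give ∫ φ dν̄₀ ≤ ∫ φ dν₀ (`SolvesDual.integral_comp_le`). Increasing
limits of such φ reach every proper lower semicontinuous convex function
(`eintegral_le_of_lipschitz`), in particular g. The direction -g is allowed too, because (1-ε)g + q
is admissible; it yields the reverse inequality for g, hence equality
(`SolvesDual.eintegral_subQuadratic_le`).

Sufficiency (`solvesDual_of_eintegral_le`): for a competitor v, Fenchel's inequality for v and its
equality case for u, both at X(y), give (v - q)∘X ≥ g∘X - (v* - u*). Integrating against ν₁,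
bounding the left side by ∫ (v - q) dν₀ and replacing ∫ g dν̄₀ by ∫ g dν₀ gives the comparison of
the two objectives. -/

theorem eintegral_congr_ae {f g : α → EReal} (h : f =ᵐ[μ] g) : eintegral f μ = eintegral g μ := by
  unfold eintegral
  congr 2
  · exact lintegral_congr_ae (h.mono fun x hx => congrArg EReal.toENNReal hx)
  · exact lintegral_congr_ae (h.mono fun x hx => congrArg (fun a : EReal => (-a).toENNReal) hx)

theorem eintegral_mono {f g : α → EReal} (h : ∀ x, f x ≤ g x) :
    eintegral f μ ≤ eintegral g μ := by
  unfold eintegral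
  refine EReal.sub_le_sub ?_ ?_
  · exact EReal.coe_ennreal_le_coe_ennreal_iff.2
      (lintegral_mono fun x => EReal.toENNReal_le_toENNReal (h x))
  · exact EReal.coe_ennreal_le_coe_ennreal_iff.2
      (lintegral_mono fun x => EReal.toENNReal_le_toENNReal (EReal.neg_le_neg_iff.2 (h x)))

theorem eintegral_coe {F : α → ℝ} (hF : Integrable F μ) :
    eintegral (fun x => (F x : EReal)) μ = ((∫ x, F x ∂μ : ℝ) : EReal) := by
  unfold eintegral
  have h1 : ∫⁻ x, ENNReal.ofReal (F x) ∂μ ≠ ⊤ := hF.lintegral_lt_top.ne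
  have h2 : ∫⁻ x, ENNReal.ofReal (-F x) ∂μ ≠ ⊤ := hF.neg.lintegral_lt_top.ne
  rw [integral_eq_lintegral_pos_part_sub_lintegral_neg_part hF]
  simp only [← EReal.coe_neg, EReal.real_coe_toENNReal]
  rw [EReal.coe_sub, EReal.coe_ennreal_toReal h1, EReal.coe_ennreal_toReal h2]

theorem eintegral_map {β : Type*} [MeasurableSpace β] {X : α → β} (hX : Measurable X)
    {f : β → EReal} (hf : Measurable f) :
    eintegral f (μ.map X) = eintegral (fun a => f (X a)) μ := by
  unfold eintegral
  rw [lintegral_map hf.ereal_toENNReal hX, lintegral_map (by fun_prop) hX]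

/-- This is a = (a - l) + l in terms of positive and negative parts, arranged without subtraction so
that it can be integrated in `ENNReal`. -/
theorem toENNReal_add_ofReal_neg {a : EReal} {l : ℝ} (h : (l : EReal) ≤ a) :
    a.toENNReal + ENNReal.ofReal (-l) =
      (a - l).toENNReal + (ENNReal.ofReal l + (-a).toENNReal) := by
  induction a with
  | bot => simp at h
  | top => simp
  | coe r =>
    have h' : l ≤ r := by exact_mod_cast h
    rw [← EReal.coe_neg, ← EReal.coe_sub]
    simp only [EReal.real_coe_toENNReal]
    rw [← ENNReal.toReal_eq_toReal_iff' (by simp) (by simp),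
      ENNReal.toReal_add (by simp) (by simp), ENNReal.toReal_add (by simp) (by simp),
      ENNReal.toReal_add (by simp) (by simp)]
    simp only [ENNReal.toReal_ofReal']
    rcases le_total 0 l with h1 | h1 <;> rcases le_total 0 r with h2 | h2 <;>
      simp [h1, h2, h'] <;> linarith

/-- The integral of a function with an integrable minorant `l`, by the excess over `l`. -/
theorem eintegral_eq_lintegral_sub_add {f : α → EReal} {l : α → ℝ} (hf : AEMeasurable f μ)
    (hl : Integrable l μ) (h : ∀ x, (l x : EReal) ≤ f x) :
    eintegral f μ =
      ((∫⁻ x, (f x - l x).toENNReal ∂μ : ENNReal) : EReal) + ((∫ x, l x ∂μ : ℝ) : EReal) := by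
  have hlm : AEMeasurable l μ := hl.aestronglyMeasurable.aemeasurable
  have key : ∫⁻ x, (f x).toENNReal ∂μ + ∫⁻ x, ENNReal.ofReal (-l x) ∂μ =
      ∫⁻ x, (f x - l x).toENNReal ∂μ +
        (∫⁻ x, ENNReal.ofReal (l x) ∂μ + ∫⁻ x, (-f x).toENNReal ∂μ) := by
    rw [← lintegral_add_left' hf.ereal_toENNReal, ← lintegral_add_left' hlm.ennreal_ofReal,
      ← lintegral_add_right']
    · exact lintegral_congr fun x => toENNReal_add_ofReal_neg (h x)
    · exact hlm.ennreal_ofReal.add hf.neg.ereal_toENNReal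
  have hN : ∫⁻ x, (-f x).toENNReal ∂μ ≤ ∫⁻ x, ENNReal.ofReal (-l x) ∂μ :=
    lintegral_mono fun x => by
      have := EReal.toENNReal_le_toENNReal (EReal.neg_le_neg_iff.2 (h x))
      rwa [← EReal.coe_neg, EReal.real_coe_toENNReal] at this
  have h1 : ∫⁻ x, ENNReal.ofReal (l x) ∂μ ≠ ⊤ := hl.lintegral_lt_top.ne
  have h2 : ∫⁻ x, ENNReal.ofReal (-l x) ∂μ ≠ ⊤ := hl.neg.lintegral_lt_top.ne
  have h3 : ∫⁻ x, (-f x).toENNReal ∂μ ≠ ⊤ := ne_top_of_le_ne_top h2 hN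
  rw [integral_eq_lintegral_pos_part_sub_lintegral_neg_part hl]
  unfold eintegral
  generalize ∫⁻ x, ENNReal.ofReal (l x) ∂μ = a at *
  generalize ∫⁻ x, ENNReal.ofReal (-l x) ∂μ = b at *
  generalize ∫⁻ x, (-f x).toENNReal ∂μ = c at *
  generalize ∫⁻ x, (f x).toENNReal ∂μ = p at *
  generalize ∫⁻ x, (f x - l x).toENNReal ∂μ = e at *
  lift a to NNReal using h1
  lift b to NNReal using h2
  lift c to NNReal using h3
  by_cases hp : p = ⊤
  · subst hp
    have he : e = ⊤ := by
      by_contra he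
      lift e to NNReal using he
      rw [top_add] at key
      exact absurd key.symm (by simp)
    subst he
    simp [-EReal.coe_sub]
  · lift p to NNReal using hp
    have he : e ≠ ⊤ := by
      rintro rfl
      rw [top_add] at key
      exact absurd key (by simp)
    lift e to NNReal using he
    have key' : (p : ℝ) + b = e + (a + c) := by exact_mod_cast key
    change ((p : ℝ) : EReal) - ((c : ℝ) : EReal) =
      ((e : ℝ) : EReal) + (((a : ℝ) - (b : ℝ) : ℝ) : EReal)
    rw [← EReal.coe_sub, ← EReal.coe_add, EReal.coe_eq_coe_iff]
    linarith

theorem integrable_toReal_of_eintegral_ne_top {f : α → EReal} {l : α → ℝ} (hf : AEMeasurable f μ)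
    (hl : Integrable l μ) (h : ∀ x, (l x : EReal) ≤ f x) (hfin : eintegral f μ ≠ ⊤) :
    Integrable (fun x => (f x).toReal) μ ∧ f =ᵐ[μ] fun x => ((f x).toReal : EReal) := by
  have hlm : AEMeasurable l μ := hl.aestronglyMeasurable.aemeasurable
  have hD : ∫⁻ x, (f x - l x).toENNReal ∂μ ≠ ⊤ := by
    intro hD
    rw [eintegral_eq_lintegral_sub_add hf hl h, hD] at hfin
    simp at hfin
  have hm : AEMeasurable (fun x => (f x - l x).toENNReal) μ := by fun_prop
  have hae : ∀ᵐ x ∂μ, f x = ((f x).toReal : EReal) := by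
    filter_upwards [ae_lt_top' hm hD] with x hx
    rw [EReal.coe_toReal]
    · intro hx'
      simp [hx'] at hx
    · intro hx'
      have := h x
      simp [hx'] at this
  refine ⟨?_, hae⟩
  have hi := integrable_toReal_of_lintegral_ne_top hm hD
  refine (hi.add hl).congr ?_
  filter_upwards [hae] with x hx
  have hlx := h x
  simp only [Pi.add_apply]
  rw [hx] at hlx ⊢
  rw [← EReal.coe_sub, EReal.real_coe_toENNReal, EReal.toReal_coe, ENNReal.toReal_ofReal]
  · ring
  · have : l x ≤ (f x).toReal := by exact_mod_cast hlx
    linarith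

theorem eintegral_add_coe {f : α → EReal} {l G : α → ℝ} (hf : AEMeasurable f μ)
    (hl : Integrable l μ) (h : ∀ x, (l x : EReal) ≤ f x) (hG : Integrable G μ) :
    eintegral (fun x => f x + (G x : EReal)) μ =
      eintegral f μ + ((∫ x, G x ∂μ : ℝ) : EReal) := by
  have hGm : AEMeasurable G μ := hG.aestronglyMeasurable.aemeasurable
  have h' : ∀ x, ((l x + G x : ℝ) : EReal) ≤ f x + (G x : EReal) := fun x => by
    rw [EReal.coe_add]
    exact add_le_add_left (h x) _
  rw [eintegral_eq_lintegral_sub_add hf hl h,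
    eintegral_eq_lintegral_sub_add (l := fun x => l x + G x) (by fun_prop) (hl.add hG) h',
    integral_add hl hG, EReal.coe_add, add_assoc]
  congr 3
  funext x
  generalize f x = a
  induction a with
  | bot => simp
  | top => simp [-EReal.coe_add]
  | coe r => norm_cast; congr 2; ring

end EIntegral

/-- The passage to the limit in each first-order argument: A is the first variation and τB the
remainder after division by the step. -/
theorem nonpos_of_forall_le_mul {A B : ℝ} (h : ∀ τ : ℝ, 0 < τ → τ < 1 → A ≤ τ * B) : A ≤ 0 := by
  have h1 : Filter.Tendsto (fun τ : ℝ => τ * B) (nhdsWithin 0 (Set.Ioi 0)) (nhds 0) := by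
    have : Filter.Tendsto (fun τ : ℝ => τ * B) (nhds 0) (nhds (0 * B)) :=
      (continuous_id.mul continuous_const).tendsto 0
    rw [zero_mul] at this
    exact this.mono_left nhdsWithin_le_nhds
  refine ge_of_tendsto h1 ?_
  filter_upwards [Ioo_mem_nhdsGT (zero_lt_one' ℝ)] with τ hτ
  exact h τ hτ.1 hτ.2

theorem coe_mul_ne_bot {k : ℝ} (hk : 0 < k) {a : EReal} (ha : a ≠ ⊥) : (k : EReal) * a ≠ ⊥ := by
  induction a with
  | bot => exact absurd rfl ha
  | top => simp [EReal.coe_mul_top_of_pos hk]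
  | coe r => rw [← EReal.coe_mul]; exact EReal.coe_ne_bot _

theorem continuous_coe_mul {k : ℝ} (hk : k ≠ 0) : Continuous fun a : EReal => (k : EReal) * a := by
  have hk' : (k : EReal) ≠ 0 := EReal.coe_ne_zero.2 hk
  refine continuous_iff_continuousAt.2 fun a => ?_
  exact (EReal.continuousAt_mul (p := ((k : EReal), a)) (Or.inl hk') (Or.inl hk')
    (Or.inl (EReal.coe_ne_bot k)) (Or.inl (EReal.coe_ne_top k))).comp
    (Continuous.prodMk_right (k : EReal)).continuousAt

theorem coe_le_of_forall_coe {α : Type*} {f : α → EReal} (hbot : ∀ x, f x ≠ ⊥) {l : α → ℝ}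
    (h : ∀ z (s : ℝ), f z = s → l z ≤ s) (z : α) : (l z : EReal) ≤ f z := by
  by_cases hz : f z = ⊤
  · rw [hz]; exact le_top
  · have := EReal.coe_toReal hz (hbot z)
    rw [← this]
    exact EReal.coe_le_coe_iff.2 (h z _ this.symm)

/-! ### Convex functions with values in (-∞, ∞] -/

section Convex

variable {E : Type*} [AddCommGroup E] [Module ℝ E]

theorem IsConvex.le_coe {f : E → EReal} (hf : IsConvex f) {x y : E} {r s a b : ℝ}
    (hx : f x ≤ r) (hy : f y ≤ s) (ha : 0 < a) (hb : 0 < b) (hab : a + b = 1) :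
    f (a • x + b • y) ≤ ((a * r + b * s : ℝ) : EReal) := by
  refine (hf.2 x y a b ha hb hab).trans ?_
  rw [EReal.coe_add, EReal.coe_mul, EReal.coe_mul]
  exact add_le_add
    (mul_le_mul_of_nonneg_left hx (EReal.coe_nonneg.2 ha.le))
    (mul_le_mul_of_nonneg_left hy (EReal.coe_nonneg.2 hb.le))

theorem isConvex_of_le_coe {f : E → EReal} (hbot : ∀ x, f x ≠ ⊥)
    (h : ∀ (x y : E) (r s a b : ℝ), f x = r → f y = s → 0 < a → 0 < b → a + b = 1 →
      f (a • x + b • y) ≤ ((a * r + b * s : ℝ) : EReal)) : IsConvex f := by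
  refine ⟨hbot, fun x y a b ha hb hab => ?_⟩
  by_cases hx : f x = ⊤
  · rw [hx, EReal.coe_mul_top_of_pos ha, EReal.top_add_of_ne_bot (coe_mul_ne_bot hb (hbot y))]
    exact le_top
  by_cases hy : f y = ⊤
  · rw [hy, EReal.coe_mul_top_of_pos hb, EReal.add_top_of_ne_bot (coe_mul_ne_bot ha (hbot x))]
    exact le_top
  have h1 := h x y (f x).toReal (f y).toReal a b (EReal.coe_toReal hx (hbot x)).symm
    (EReal.coe_toReal hy (hbot y)).symm ha hb hab
  rwa [EReal.coe_add, EReal.coe_mul, EReal.coe_mul, EReal.coe_toReal hx (hbot x),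
    EReal.coe_toReal hy (hbot y)] at h1

theorem IsConvex.add_convexOn {f : E → EReal} (hf : IsConvex f) {φ : E → ℝ}
    (hφ : ConvexOn ℝ Set.univ φ) : IsConvex (fun x => f x + (φ x : EReal)) := by
  refine isConvex_of_le_coe (fun x => ?_) fun x y r s a b hx hy ha hb hab => ?_
  · rw [Ne, EReal.add_eq_bot_iff]
    simp [hf.1 x]
  · have h1 : f x = ((r - φ x : ℝ) : EReal) := by
      rw [EReal.coe_sub, ← hx, EReal.add_sub_cancel_right]
    have h2 : f y = ((s - φ y : ℝ) : EReal) := by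
      rw [EReal.coe_sub, ← hy, EReal.add_sub_cancel_right]
    refine (add_le_add (hf.le_coe h1.le h2.le ha hb hab) (EReal.coe_le_coe_iff.2
      (hφ.2 (Set.mem_univ x) (Set.mem_univ y) ha.le hb.le hab))).trans ?_
    rw [← EReal.coe_add, EReal.coe_le_coe_iff]
    simp only [smul_eq_mul]
    linarith

theorem IsConvex.coe_mul {f : E → EReal} (hf : IsConvex f) {k : ℝ} (hk : 0 < k) :
    IsConvex (fun x => (k : EReal) * f x) := by
  have hpos : (0 : EReal) < k := EReal.coe_pos.2 hk
  refine ⟨fun x => coe_mul_ne_bot hk (hf.1 x), fun x y a b ha hb hab => ?_⟩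
  refine (mul_le_mul_of_nonneg_left (hf.2 x y a b ha hb hab) hpos.le).trans ?_
  rw [EReal.left_distrib_of_nonneg_of_ne_top hpos.le (EReal.coe_ne_top _)]
  simp only [← mul_assoc, mul_comm (k : EReal)]
  exact le_rfl

theorem isConvex_coe {φ : E → ℝ} (hφ : ConvexOn ℝ Set.univ φ) :
    IsConvex (fun x => (φ x : EReal)) := by
  refine ⟨fun x => EReal.coe_ne_bot _, fun x y a b ha hb hab => ?_⟩
  have h := hφ.2 (Set.mem_univ x) (Set.mem_univ y) ha.le hb.le hab
  simp only [smul_eq_mul] at h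
  change (φ (a • x + b • y) : EReal) ≤ (a : EReal) * (φ x : EReal) + (b : EReal) * (φ y : EReal)
  exact_mod_cast h

end Convex

/-! ### Affine minorants and Lipschitz approximation from below -/

section Affine

variable {E : Type*} [NormedAddCommGroup E] [NormedSpace ℝ E]

theorem LowerSemicontinuous.add_coe {E : Type*} [TopologicalSpace E] {f : E → EReal}
    (hf : LowerSemicontinuous f) {F : E → ℝ} (hF : Continuous F) :
    LowerSemicontinuous (fun x => f x + (F x : EReal)) :=
  hf.add' (continuous_coe_real_ereal.comp hF).lowerSemicontinuous fun _ =>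
    EReal.continuousAt_add (Or.inr (EReal.coe_ne_bot _)) (Or.inr (EReal.coe_ne_top _))

theorem IsConvex.convex_epigraph {f : E → EReal} (hf : IsConvex f) :
    Convex ℝ {p : E × ℝ | f p.1 ≤ p.2} := by
  rw [convex_iff_forall_pos]
  intro p hp q hq a b ha hb hab
  exact hf.le_coe hp hq ha hb hab

theorem isClosed_real_epigraph {E : Type*} [TopologicalSpace E] {f : E → EReal}
    (hf : LowerSemicontinuous f) :
    IsClosed {p : E × ℝ | f p.1 ≤ p.2} :=
  hf.isClosed_epigraph.preimage
    (continuous_fst.prodMk (continuous_coe_real_ereal.comp continuous_snd))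

/-- Separation of a point strictly below the graph from the epigraph. -/
theorem IsConvex.exists_separation {f : E → EReal} (hf : IsConvex f) (hl : LowerSemicontinuous f)
    (hp : ∃ x, f x ≠ ⊤) {x : E} {a : ℝ} (ha : (a : EReal) < f x) :
    ∃ (p : E →L[ℝ] ℝ) (q c : ℝ), 0 ≤ q ∧ p x + q * a < c ∧
      ∀ (z : E) (s : ℝ), f z ≤ s → c < p z + q * s := by
  obtain ⟨L, c, h1, h2⟩ := geometric_hahn_banach_point_closed hf.convex_epigraph
    (isClosed_real_epigraph hl) (x := (x, a)) (by simpa using ha)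
  have hL : ∀ (z : E) (s : ℝ), L (z, s) = L (z, 0) + L (0, 1) * s := fun z s => by
    have : (z, s) = (z, (0 : ℝ)) + s • ((0 : E), (1 : ℝ)) := by simp
    rw [this, map_add, map_smul, smul_eq_mul, mul_comm]
  refine ⟨L.comp (ContinuousLinearMap.inl ℝ E ℝ), L (0, 1), c, ?_, ?_, fun z s hz => ?_⟩
  · obtain ⟨x₀, hx₀⟩ := hp
    by_contra hq
    push Not at hq
    set q := L (0, 1) with hqdef
    set r := (f x₀).toReal
    have hr : f x₀ ≤ r := EReal.le_coe_toReal hx₀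
    -- The epigraph is unbounded upwards: if q < 0, this height puts a point of the epigraph on the
    -- wrong side of the hyperplane.
    set s := max r ((c - L (x₀, 0)) / q)
    have hs : f x₀ ≤ (s : ℝ) := hr.trans (EReal.coe_le_coe_iff.2 (le_max_left _ _))
    have := h2 (x₀, s) hs
    rw [hL] at this
    have h3 : q * s ≤ q * ((c - L (x₀, 0)) / q) :=
      mul_le_mul_of_nonpos_left (le_max_right _ _) hq.le
    rw [mul_div_cancel₀ _ hq.ne] at h3
    linarith
  · rw [hL] at h1
    simpa using h1
  · have := h2 (z, s) hz
    rw [hL] at this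
    simpa using this

theorem IsConvex.exists_affine_le_of_separation {f : E → EReal} (hf : IsConvex f)
    {x : E} {a : ℝ} {p : E →L[ℝ] ℝ} {q c : ℝ} (hq : 0 < q) (hx : p x + q * a < c)
    (h : ∀ (z : E) (s : ℝ), f z ≤ s → c < p z + q * s) :
    ∃ (l : E →L[ℝ] ℝ) (b : ℝ), (∀ z, ((l z + b : ℝ) : EReal) ≤ f z) ∧ a < l x + b := by
  refine ⟨-(q⁻¹ • p), c / q, coe_le_of_forall_coe hf.1 fun z s hz => ?_, ?_⟩
  · have := h z s hz.le
    have h' : (c - p z) / q ≤ s := by rw [div_le_iff₀ hq]; linarith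
    calc _ = (c - p z) / q := by simp; field_simp; ring
      _ ≤ s := h'
  · have h' : a < (c - p x) / q := by rw [lt_div_iff₀ hq]; linarith
    calc a < (c - p x) / q := h'
      _ = _ := by simp; field_simp; ring

theorem IsConvex.exists_affine_le {f : E → EReal} (hf : IsConvex f) (hl : LowerSemicontinuous f)
    (hp : ∃ x, f x ≠ ⊤) :
    ∃ (l : E →L[ℝ] ℝ) (b : ℝ), ∀ z, ((l z + b : ℝ) : EReal) ≤ f z := by
  obtain ⟨x, hx⟩ := hp
  have hr := EReal.coe_toReal hx (hf.1 x)
  set r := (f x).toReal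
  obtain ⟨p, q, c, hq, h1, h2⟩ := hf.exists_separation hl ⟨x, hx⟩ (x := x) (a := r - 1)
    (by rw [← hr]; exact EReal.coe_lt_coe_iff.2 (by linarith))
  have h3 := h2 x r hr.ge
  -- The hyperplane separates two points of the same vertical line, at heights r - 1 and r, so it is
  -- not vertical.
  have hq' : 0 < q := by nlinarith
  obtain ⟨l, b, hlb, -⟩ := hf.exists_affine_le_of_separation hq' h1 h2
  exact ⟨l, b, hlb⟩

/-- A proper lower semicontinuous convex function is the supremum of its affine minorants. -/
theorem IsConvex.exists_affine_le_of_lt {f : E → EReal} (hf : IsConvex f)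
    (hl : LowerSemicontinuous f) (hp : ∃ x, f x ≠ ⊤) {x : E} {a : ℝ} (ha : (a : EReal) < f x) :
    ∃ (l : E →L[ℝ] ℝ) (b : ℝ), (∀ z, ((l z + b : ℝ) : EReal) ≤ f z) ∧ a < l x + b := by
  obtain ⟨p, q, c, hq, h1, h2⟩ := hf.exists_separation hl hp ha
  rcases hq.eq_or_lt with rfl | hq
  -- Vertical hyperplane: c - p is negative wherever f is finite and positive at x. Adding a large
  -- multiple of it to any affine minorant keeps a minorant and raises the value at x above a.
  · obtain ⟨l, b, hlb⟩ := hf.exists_affine_le hl hp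
    have hpos : 0 < c - p x := by linarith
    obtain ⟨n, hn⟩ := exists_nat_gt ((a - (l x + b)) / (c - p x))
    rw [div_lt_iff₀ hpos] at hn
    refine ⟨l - (n : ℝ) • p, b + n * c, coe_le_of_forall_coe hf.1 fun z s hz => ?_, ?_⟩
    · have h3 := h2 z s hz.le
      have h4 : l z + b ≤ s := by
        have := hlb z
        rw [hz] at this
        exact_mod_cast this
      have h5 : 0 ≤ (n : ℝ) * (p z - c) := mul_nonneg n.cast_nonneg (by linarith)
      simp
      linarith
    · simp
      linarith
  · exact hf.exists_affine_le_of_separation hq h1 h2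

/-- A proper lower semicontinuous convex function is the limit of an increasing sequence of
real-valued Lipschitz convex functions. -/
theorem IsConvex.exists_monotone_lipschitz [SecondCountableTopology E] {f : E → EReal}
    (hf : IsConvex f) (hl : LowerSemicontinuous f) (hp : ∃ x, f x ≠ ⊤) :
    ∃ φ : ℕ → E → ℝ, Monotone φ ∧ (∀ n, ConvexOn ℝ Set.univ (φ n)) ∧
      (∀ n, ∃ K, LipschitzWith K (φ n)) ∧ ∀ x, ⨆ n, (φ n x : EReal) = f x := by
  let A : Set (E → EReal) := {g | (∀ x, g x ≤ f x) ∧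
    ∃ (l : E →L[ℝ] ℝ) (b : ℝ), g = fun x => ((l x + b : ℝ) : EReal)}
  have hA : IsLUB A f := by
    refine ⟨fun g hg => hg.1, fun h hh x => ?_⟩
    by_contra! hlt
    obtain ⟨a, h1, h2⟩ := EReal.lt_iff_exists_real_btwn.1 hlt
    obtain ⟨l, b, hlb, hx⟩ := hf.exists_affine_le_of_lt hl hp h2
    have h3 := hh (show (fun x => ((l x + b : ℝ) : EReal)) ∈ A from ⟨hlb, l, b, rfl⟩) x
    exact absurd (h1.trans (EReal.coe_lt_coe_iff.2 hx)) h3.not_gt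
  have hAc : ∀ g ∈ A, LowerSemicontinuous g := by
    rintro g ⟨-, l, b, rfl⟩
    exact Continuous.lowerSemicontinuous (continuous_coe_real_ereal.comp (by fun_prop))
  -- Second countability extracts a countable family of affine minorants with the same supremum; its
  -- finite maxima are the required sequence.
  obtain ⟨A', hA'A, hA'c, hA'⟩ := exists_countable_lowerSemicontinuous_isLUB hAc hA
  have hne : A'.Nonempty := by
    by_contra! h
    rw [h, isLUB_empty_iff] at hA'
    have := hA' (fun _ => ⊥) 0
    exact hf.1 0 (le_bot_iff.1 this)
  obtain ⟨e, he⟩ := hA'c.exists_eq_range hne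
  have heA : ∀ n, e n ∈ A := fun n => hA'A (he ▸ Set.mem_range_self n)
  choose hle l b hlb using heA
  let ψ : ℕ → E → ℝ := fun n x => l n x + b n
  have hψ : ∀ n x, e n x = (ψ n x : EReal) := fun n x => by rw [hlb n]
  have hps : ∀ n x, partialSups ψ (n + 1) x = max (partialSups ψ n x) (ψ (n + 1) x) := fun n x => by
    rw [partialSups_add_one]; rfl
  refine ⟨partialSups ψ, (partialSups ψ).monotone, fun n => ?_, fun n => ?_,
    fun x => ?_⟩
  · induction n with
    | zero =>
      rw [partialSups_zero]
      exact ((l 0).toLinearMap.convexOn convex_univ).add_const _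
    | succ n ih =>
      rw [partialSups_add_one]
      exact ih.sup (((l (n + 1)).toLinearMap.convexOn convex_univ).add_const _)
  · have hlip : ∀ n, LipschitzWith ‖l n‖₊ (ψ n) := fun n => by
      refine LipschitzWith.of_dist_le_mul fun x y => ?_
      have := (l n).lipschitz.dist_le_mul x y
      simpa [ψ] using this
    induction n with
    | zero => exact ⟨_, by rw [partialSups_zero]; exact hlip 0⟩
    | succ n ih =>
      obtain ⟨K, hK⟩ := ih
      refine ⟨max K ‖l (n + 1)‖₊, ?_⟩
      rw [partialSups_add_one]
      exact hK.max (hlip (n + 1))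
  · apply le_antisymm
    · refine iSup_le fun n => ?_
      induction n with
      | zero => rw [partialSups_zero, ← hψ]; exact hle 0 x
      | succ n ih =>
        rw [hps]
        rcases max_choice (partialSups ψ n x) (ψ (n + 1) x) with h | h <;> rw [h]
        · exact ih
        · rw [← hψ]; exact hle (n + 1) x
    · have hub : (fun x => ⨆ n, (partialSups ψ n x : EReal)) ∈ upperBounds A' := by
        rw [he]
        rintro _ ⟨n, rfl⟩ x
        rw [hψ]
        exact le_iSup_of_le n (EReal.coe_le_coe_iff.2 (le_partialSups ψ n x))
      exact hA'.2 hub x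

end Affine

/-! ### Strong convexity and regularity of the Legendre transform -/

section Conjugate

variable {d : ℕ} {t : ℝ}

theorem sub_one_div_pos (ht : 1 < t) : 0 < (t - 1) / t :=
  div_pos (by linarith) (by linarith)

theorem subQuadratic_ne_bot {m : ℝ} {u : EuclideanSpace ℝ (Fin d) → EReal}
    {x : EuclideanSpace ℝ (Fin d)} (hx : u x ≠ ⊥) :
    subQuadratic m u x ≠ ⊥ := by
  unfold subQuadratic
  generalize u x = a at *
  induction a with
  | bot => exact absurd rfl hx
  | top => rw [EReal.top_sub_coe]; exact top_ne_bot
  | coe r => rw [← EReal.coe_sub]; exact EReal.coe_ne_bot _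

theorem subQuadratic_eq_add (m : ℝ) (u : EuclideanSpace ℝ (Fin d) → EReal) :
    subQuadratic m u = fun x => u x + ((-(m * (‖x‖ ^ 2 / 2)) : ℝ) : EReal) := by
  funext x
  rw [EReal.coe_neg]
  rfl

theorem eq_subQuadratic_add (m : ℝ) (u : EuclideanSpace ℝ (Fin d) → EReal)
    (x : EuclideanSpace ℝ (Fin d)) :
    u x = subQuadratic m u x + ((m * (‖x‖ ^ 2 / 2) : ℝ) : EReal) := by
  unfold subQuadratic
  rw [EReal.sub_add_cancel]

theorem subQuadratic_add_coe (m : ℝ) (g : EuclideanSpace ℝ (Fin d) → EReal) :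
    subQuadratic m (fun x => g x + ((m * (‖x‖ ^ 2 / 2) : ℝ) : EReal)) = g := by
  funext x
  unfold subQuadratic
  rw [EReal.add_sub_cancel_right]

theorem subQuadratic_of_eq_coe {m : ℝ} {u : EuclideanSpace ℝ (Fin d) → EReal}
    {x : EuclideanSpace ℝ (Fin d)} {r : ℝ} (h : u x = r) :
    subQuadratic m u x = ((r - m * (‖x‖ ^ 2 / 2) : ℝ) : EReal) := by
  unfold subQuadratic
  rw [h, EReal.coe_sub]

theorem lowerSemicontinuous_subQuadratic {m : ℝ} {u : EuclideanSpace ℝ (Fin d) → EReal}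
    (hu : LowerSemicontinuous u) :
    LowerSemicontinuous (subQuadratic m u) := by
  rw [subQuadratic_eq_add]
  exact LowerSemicontinuous.add_coe hu (by fun_prop)

theorem isAdmissible_add_quadratic {g : EuclideanSpace ℝ (Fin d) → EReal} (hg : IsConvex g)
    (hl : LowerSemicontinuous g) (hp : ∃ x, g x ≠ ⊤) :
    IsAdmissible t (fun x => g x + (((t - 1) / t * (‖x‖ ^ 2 / 2) : ℝ) : EReal)) where
  ne_bot x := by
    rw [Ne, EReal.add_eq_bot_iff]
    simp only [EReal.coe_ne_bot, or_false]
    exact hg.1 x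
  exists_ne_top := by
    obtain ⟨x, hx⟩ := hp
    exact ⟨x, EReal.add_ne_top hx (EReal.coe_ne_top _)⟩
  lowerSemicontinuous := LowerSemicontinuous.add_coe hl (by fun_prop)
  convex := by rwa [subQuadratic_add_coe]

theorem IsAdmissible.subQuadratic_proper {u : EuclideanSpace ℝ (Fin d) → EReal}
    (hu : IsAdmissible t u) (m : ℝ) :
    ∃ x, subQuadratic m u x ≠ ⊤ := by
  obtain ⟨x, hx⟩ := hu.exists_ne_top
  refine ⟨x, ?_⟩
  rw [subQuadratic_eq_add]
  exact EReal.add_ne_top hx (EReal.coe_ne_top _)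

/-- An admissible potential is strongly convex. -/
theorem IsAdmissible.le_coe {u : EuclideanSpace ℝ (Fin d) → EReal} (hu : IsAdmissible t u)
    {x y : EuclideanSpace ℝ (Fin d)} {r s a b : ℝ}
    (hx : u x = r) (hy : u y = s) (ha : 0 < a) (hb : 0 < b) (hab : a + b = 1) :
    u (a • x + b • y) ≤
      ((a * r + b * s - (t - 1) / t / 2 * (a * b) * ‖x - y‖ ^ 2 : ℝ) : EReal) := by
  set m := (t - 1) / t
  have h := hu.convex.le_coe (subQuadratic_of_eq_coe (m := m) hx).le
    (subQuadratic_of_eq_coe (m := m) hy).le ha hb hab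
  rw [eq_subQuadratic_add m u]
  refine (add_le_add_left h _).trans ?_
  rw [← EReal.coe_add, EReal.coe_le_coe_iff]
  apply le_of_eq
  have h1 : ‖a • x + b • y‖ ^ 2 = a ^ 2 * ‖x‖ ^ 2 + 2 * (a * b) * inner ℝ x y +
      b ^ 2 * ‖y‖ ^ 2 := by
    rw [norm_add_sq_real, norm_smul, norm_smul, real_inner_smul_left, real_inner_smul_right,
      mul_pow, mul_pow, Real.norm_eq_abs, Real.norm_eq_abs, sq_abs, sq_abs]
    ring
  rw [h1, norm_sub_sq_real]
  obtain rfl : b = 1 - a := by linarith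
  ring

/-- An affine minorant of the convex part makes u - ⟨·, y⟩ coercive, so a minimizer over a large
closed ball is global. -/
theorem IsAdmissible.exists_isMinOn (ht : 1 < t) {u : EuclideanSpace ℝ (Fin d) → EReal}
    (hu : IsAdmissible t u) (y : EuclideanSpace ℝ (Fin d)) :
    ∃ (X : EuclideanSpace ℝ (Fin d)) (r : ℝ), u X = r ∧ ∀ z,
    ((r + inner ℝ (z - X) y : ℝ) : EReal) ≤ u z := by
  set m := (t - 1) / t
  have hm0 : 0 < m := sub_one_div_pos ht
  obtain ⟨l, c, hlc⟩ := hu.convex.exists_affine_le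
    (lowerSemicontinuous_subQuadratic hu.lowerSemicontinuous) (hu.subQuadratic_proper m)
  have hlow : ∀ z (s : ℝ), u z = s → l z + c + m * (‖z‖ ^ 2 / 2) ≤ s := fun z s hz => by
    have h := hlc z
    rw [subQuadratic_of_eq_coe hz, EReal.coe_le_coe_iff] at h
    linarith
  obtain ⟨x₁, hx₁⟩ := hu.exists_ne_top
  have hr₁ := (EReal.coe_toReal hx₁ (hu.ne_bot x₁)).symm
  set r₁ := (u x₁).toReal
  set A := r₁ - inner ℝ x₁ y - c
  set K := ‖l‖ + ‖y‖
  -- Beyond R, m‖z‖²/2 ≥ (K + |A|)‖z‖ ≥ K‖z‖ + |A|, so the objective is at least its value at x₁,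
  -- which lies in the ball.
  set R := max (max ‖x₁‖ 1) ((K + |A|) * 2 / m)
  have hR1 : ‖x₁‖ ≤ R := (le_max_left _ _).trans (le_max_left _ _)
  have hR2 : 1 ≤ R := (le_max_right _ _).trans (le_max_left _ _)
  have hR3 : (K + |A|) * 2 / m ≤ R := le_max_right _ _
  have hfl : LowerSemicontinuous fun z => u z + ((-inner ℝ z y : ℝ) : EReal) :=
    LowerSemicontinuous.add_coe hu.lowerSemicontinuous (by fun_prop)
  have hx₁R : x₁ ∈ Metric.closedBall (0 : EuclideanSpace ℝ (Fin d)) R := by simpa using hR1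
  obtain ⟨X, -, hX⟩ := (hfl.lowerSemicontinuousOn _).exists_isMinOn ⟨x₁, hx₁R⟩
    (isCompact_closedBall (0 : EuclideanSpace ℝ (Fin d)) R)
  have hXx₁ := hX hx₁R
  simp only [Set.mem_ofPred_eq, hr₁, ← EReal.coe_add] at hXx₁
  have hXtop : u X ≠ ⊤ := by
    intro h
    rw [h, EReal.top_add_coe, top_le_iff] at hXx₁
    exact EReal.coe_ne_top _ hXx₁
  have hr := (EReal.coe_toReal hXtop (hu.ne_bot X)).symm
  set r := (u X).toReal
  rw [hr, ← EReal.coe_add, EReal.coe_le_coe_iff] at hXx₁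
  refine ⟨X, r, hr, coe_le_of_forall_coe hu.ne_bot fun z s hz => ?_⟩
  rw [inner_sub_left]
  by_cases hzR : z ∈ Metric.closedBall (0 : EuclideanSpace ℝ (Fin d)) R
  · have h := hX hzR
    simp only [Set.mem_ofPred_eq, hr, hz, ← EReal.coe_add, EReal.coe_le_coe_iff] at h
    linarith
  · have hz' : R < ‖z‖ := by simpa using hzR
    have h1 := hlow z s hz
    have h2 : -(‖l‖ * ‖z‖) ≤ l z := neg_le_of_abs_le (l.le_opNorm z)
    have h3 : inner ℝ z y ≤ ‖z‖ * ‖y‖ := real_inner_le_norm z y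
    have h4 : (K + |A|) * 2 ≤ m * ‖z‖ := by
      have := (div_le_iff₀ hm0).1 (hR3.trans hz'.le)
      linarith
    have h5 : |A| * 1 ≤ |A| * ‖z‖ := mul_le_mul_of_nonneg_left (by linarith) (abs_nonneg A)
    have h6 : (K + |A|) * 2 * ‖z‖ ≤ m * ‖z‖ * ‖z‖ :=
      mul_le_mul_of_nonneg_right h4 (norm_nonneg z)
    have h7 : A ≤ |A| := le_abs_self A
    have h8 : K * ‖z‖ = ‖l‖ * ‖z‖ + ‖z‖ * ‖y‖ := by ring
    have h9 : A = r₁ - inner ℝ x₁ y - c := rfl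
    nlinarith

/-- The minimizer of `u - ⟨·, y⟩`, with the quadratic growth given by strong convexity. -/
theorem IsAdmissible.exists_strong_minimizer (ht : 1 < t) {u : EuclideanSpace ℝ (Fin d) → EReal}
    (hu : IsAdmissible t u) (y : EuclideanSpace ℝ (Fin d)) :
    ∃ (X : EuclideanSpace ℝ (Fin d)) (r : ℝ), u X = r ∧
      ∀ z, ((r + inner ℝ (z - X) y + (t - 1) / t / 2 * ‖z - X‖ ^ 2 : ℝ) : EReal) ≤ u z := by
  obtain ⟨X, r, hr, hX⟩ := hu.exists_isMinOn ht y
  refine ⟨X, r, hr, coe_le_of_forall_coe hu.ne_bot fun z s hz => ?_⟩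
  set m := (t - 1) / t
  rw [← sub_nonpos]
  -- Minimality is tested at X + τ(z - X). After division by τ, strong convexity supplies (1 -
  -- τ)(m/2)‖z - X‖², which falls short of the claim by τB.
  refine nonpos_of_forall_le_mul (B := m / 2 * ‖z - X‖ ^ 2) fun τ h0 h1 => ?_
  have h2 := (hX ((1 - τ) • X + τ • z)).trans
    (hu.le_coe hr hz (by linarith : 0 < 1 - τ) h0 (by ring))
  rw [EReal.coe_le_coe_iff] at h2
  have h3 : (1 - τ) • X + τ • z - X = τ • (z - X) := by module
  rw [h3, real_inner_smul_left, norm_sub_rev X z] at h2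
  change r + τ * inner ℝ (z - X) y ≤
    (1 - τ) * r + τ * s - m / 2 * ((1 - τ) * τ) * ‖z - X‖ ^ 2 at h2
  refine le_of_mul_le_mul_left (a := τ) ?_ h0
  linarith

theorem legendre_le_iff {u : EuclideanSpace ℝ (Fin d) → EReal} (hu : ∀ x, u x ≠ ⊥)
    {y : EuclideanSpace ℝ (Fin d)} {c : ℝ} :
    legendre u y ≤ c ↔ ∀ x (r : ℝ), u x = r → inner ℝ x y - r ≤ c := by
  unfold legendre
  rw [iSup_le_iff]
  refine forall_congr' fun x => ⟨fun h r hr => ?_, fun h => ?_⟩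
  · rw [hr] at h
    exact_mod_cast h
  · by_cases hx : u x = ⊤
    · simp [hx]
    · have := (EReal.coe_toReal hx (hu x)).symm
      rw [this]
      exact_mod_cast h _ this

theorem coe_le_legendre {u : EuclideanSpace ℝ (Fin d) → EReal} {x y : EuclideanSpace ℝ (Fin d)}
    {r : ℝ} (hx : u x = r) :
    ((inner ℝ x y - r : ℝ) : EReal) ≤ legendre u y := by
  refine le_iSup_of_le x ?_
  rw [hx, EReal.coe_sub]

theorem hasGradientAt_of_quadratic {P : EuclideanSpace ℝ (Fin d) → ℝ}
    {X y : EuclideanSpace ℝ (Fin d)} {C : ℝ}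
    (h : ∀ z, |P z - P y - inner ℝ X (z - y)| ≤ C * ‖z - y‖ ^ 2) : HasGradientAt P X y := by
  rw [hasGradientAt_iff_isLittleO]
  have h1 : (fun z => P z - P y - inner ℝ X (z - y)) =O[nhds y] fun z => ‖z - y‖ ^ 2 :=
    Asymptotics.IsBigO.of_bound C (Filter.Eventually.of_forall fun z => by simpa using h z)
  refine h1.trans_isLittleO ?_
  have h2 : (fun z : EuclideanSpace ℝ (Fin d) => ‖z - y‖ ^ 2) = fun z => ‖z - y‖ * ‖z - y‖ := by
    funext z; ring
  rw [h2, ← Asymptotics.isLittleO_norm_right]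
  have h3 : (fun z : EuclideanSpace ℝ (Fin d) => ‖z - y‖) =o[nhds y] fun _ => (1 : ℝ) := by
    rw [Asymptotics.isLittleO_one_iff]
    have : Continuous fun z : EuclideanSpace ℝ (Fin d) => ‖z - y‖ := by fun_prop
    simpa using this.tendsto y
  simpa using h3.mul_isBigO
    (Asymptotics.isBigO_refl (fun z : EuclideanSpace ℝ (Fin d) => ‖z - y‖) (nhds y))

/-- The Legendre transform `P` of an admissible potential `u`, its gradient `X`, the equality case
of the Fenchel inequality and its quantitative strengthening. -/
structure IsConjugate (t : ℝ) (u : EuclideanSpace ℝ (Fin d) → EReal)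
    (P : EuclideanSpace ℝ (Fin d) → ℝ)
    (X : EuclideanSpace ℝ (Fin d) → EuclideanSpace ℝ (Fin d)) : Prop where
  legendre_eq : ∀ y, legendre u y = P y
  apply_eq : ∀ y, u (X y) = ((inner ℝ (X y) y - P y : ℝ) : EReal)
  le_apply : ∀ y z, ((inner ℝ z y - P y + (t - 1) / t / 2 * ‖z - X y‖ ^ 2 : ℝ) : EReal) ≤ u z
  abs_le : ∀ y z, |P z - P y - inner ℝ (X y) (z - y)| ≤ t / (t - 1) / 2 * ‖z - y‖ ^ 2
  lipschitz : LipschitzWith (Real.toNNReal (t / (t - 1))) X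

/-- Everything follows from the quadratic growth at the minimizers X(y). Using it at y and at z and
adding gives strong monotonicity of X, hence the Lipschitz bound 1/m = t/(t-1). -/
theorem IsAdmissible.exists_isConjugate (ht : 1 < t) {u : EuclideanSpace ℝ (Fin d) → EReal}
    (hu : IsAdmissible t u) :
    ∃ P X, IsConjugate t u P X := by
  choose X U hXU hle using hu.exists_strong_minimizer ht
  have ht0 : 0 < t := by linarith
  have ht1 : 0 < t - 1 := by linarith
  set m := (t - 1) / t with hm
  have hm0 : 0 < m := sub_one_div_pos ht
  have hinv : t / (t - 1) = 1 / m := by rw [hm]; field_simp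
  let P : EuclideanSpace ℝ (Fin d) → ℝ := fun y => inner ℝ (X y) y - U y
  have hleg : ∀ y, legendre u y = P y := fun y => by
    refine le_antisymm ((legendre_le_iff hu.ne_bot).2 fun x r hx => ?_) (coe_le_legendre (hXU y))
    have h := hle y x
    rw [hx, EReal.coe_le_coe_iff, inner_sub_left] at h
    have : 0 ≤ m / 2 * ‖x - X y‖ ^ 2 := by positivity
    simp only [P]
    linarith
  have hgrow : ∀ y z (s : ℝ), u z = s →
      inner ℝ z y - P y + m / 2 * ‖z - X y‖ ^ 2 ≤ s := fun y z s hz => by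
    have h := hle y z
    rw [hz, EReal.coe_le_coe_iff, inner_sub_left] at h
    simp only [P]
    linarith
  have hmono : ∀ y z, m * ‖X z - X y‖ ^ 2 ≤ inner ℝ (X z - X y) (z - y) := fun y z => by
    have h1 := hgrow y (X z) _ (hXU z)
    have h2 := hgrow z (X y) _ (hXU y)
    rw [norm_sub_rev] at h2
    simp only [P] at h1 h2
    simp only [inner_sub_left, inner_sub_right]
    linarith
  refine ⟨P, X, hleg, fun y => by rw [hXU]; simp [P], fun y => ?_, fun y z => ?_, ?_⟩
  · exact coe_le_of_forall_coe hu.ne_bot (hgrow y)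
  · have h1 := hgrow y (X z) _ (hXU z)
    have h2 := hgrow z (X y) _ (hXU y)
    have h3 : inner ℝ (X z - X y) (z - y) ≤ ‖X z - X y‖ * ‖z - y‖ := real_inner_le_norm _ _
    -- Young's inequality: the growth term in `h1` absorbs the first summand, leaving the upper
    -- bound on the remainder of P. The lower bound, by 0, comes from `h2`.
    have h4 : ‖X z - X y‖ * ‖z - y‖ ≤ m / 2 * ‖X z - X y‖ ^ 2 + 1 / m / 2 * ‖z - y‖ ^ 2 := by
      have h5 : m / 2 * ‖X z - X y‖ ^ 2 + 1 / m / 2 * ‖z - y‖ ^ 2 - ‖X z - X y‖ * ‖z - y‖ =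
          1 / (2 * m) * (m * ‖X z - X y‖ - ‖z - y‖) ^ 2 := by
        field_simp
        ring
      have : 0 ≤ 1 / (2 * m) * (m * ‖X z - X y‖ - ‖z - y‖) ^ 2 := by positivity
      linarith
    have h6 : 0 ≤ m / 2 * ‖X y - X z‖ ^ 2 := by positivity
    have h7 : 0 ≤ 1 / m / 2 * ‖z - y‖ ^ 2 := by positivity
    rw [hinv]
    simp only [P] at *
    simp only [inner_sub_left, inner_sub_right] at *
    rw [abs_le]
    constructor <;> linarith
  · refine LipschitzWith.of_dist_le_mul fun y z => ?_
    rw [Real.coe_toNNReal _ (by positivity), hinv, dist_eq_norm, dist_eq_norm]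
    have h1 := (hmono z y).trans (real_inner_le_norm _ _)
    rcases (norm_nonneg (X y - X z)).eq_or_lt with h | h
    · rw [← h]; positivity
    · rw [one_div, ← div_eq_inv_mul, le_div_iff₀ hm0]
      nlinarith

theorem IsConjugate.hasGradientAt {u : EuclideanSpace ℝ (Fin d) → EReal}
    {P : EuclideanSpace ℝ (Fin d) → ℝ} {X : EuclideanSpace ℝ (Fin d) → EuclideanSpace ℝ (Fin d)}
    (h : IsConjugate t u P X) (y : EuclideanSpace ℝ (Fin d)) : HasGradientAt P (X y) y :=
  hasGradientAt_of_quadratic (h.abs_le y)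

theorem IsConjugate.toReal_legendre {u : EuclideanSpace ℝ (Fin d) → EReal}
    {P : EuclideanSpace ℝ (Fin d) → ℝ} {X : EuclideanSpace ℝ (Fin d) → EuclideanSpace ℝ (Fin d)}
    (h : IsConjugate t u P X) : (fun y => (legendre u y).toReal) = P := by
  funext y
  rw [h.legendre_eq, EReal.toReal_coe]

theorem IsConjugate.gradLegendre_eq {u : EuclideanSpace ℝ (Fin d) → EReal}
    {P : EuclideanSpace ℝ (Fin d) → ℝ} {X : EuclideanSpace ℝ (Fin d) → EuclideanSpace ℝ (Fin d)}
    (h : IsConjugate t u P X) : gradLegendre u = X := by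
  unfold gradLegendre
  rw [h.toReal_legendre]
  funext y
  exact (h.hasGradientAt y).gradient

end Conjugate

/-! ### From Lipschitz to lower semicontinuous convex test functions -/

section ConvexOrder

theorem integrable_of_lipschitzWith {E : Type*} [NormedAddCommGroup E] [MeasurableSpace E]
    [BorelSpace E] {μ : Measure E} [IsFiniteMeasure μ]
    (hμ : Integrable (fun x => x) μ) {φ : E → ℝ} {K : NNReal} (hφ : LipschitzWith K φ) :
    Integrable φ μ := by
  refine Integrable.mono' (g := fun x => |φ 0| + K * ‖x‖)
    ((integrable_const _).add (hμ.norm.const_mul _)) hφ.continuous.aestronglyMeasurable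
    (Filter.Eventually.of_forall fun x => ?_)
  have h := hφ.dist_le_mul x 0
  rw [Real.dist_eq, dist_zero_right] at h
  have h2 := abs_sub_abs_le_abs_sub (φ x) (φ 0)
  rw [Real.norm_eq_abs]
  linarith

variable {E : Type*} [NormedAddCommGroup E] [NormedSpace ℝ E] [MeasurableSpace E] [BorelSpace E]
  [SecondCountableTopology E]

/-- Comparison of the integrals of Lipschitz convex functions implies that of the integrals of
all lower semicontinuous convex functions. -/
theorem eintegral_le_of_lipschitz {μ ν : Measure E} [IsProbabilityMeasure μ]
    [IsProbabilityMeasure ν] (hμ : Integrable (fun x => x) μ) (hν : Integrable (fun x => x) ν)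
    (h : ∀ φ : E → ℝ, ConvexOn ℝ Set.univ φ → (∃ K, LipschitzWith K φ) →
      ∫ x, φ x ∂μ ≤ ∫ x, φ x ∂ν)
    {φ : E → EReal} (hl : LowerSemicontinuous φ) (hc : IsConvex φ) :
    eintegral φ μ ≤ eintegral φ ν := by
  by_cases htop : eintegral φ ν = ⊤
  · rw [htop]; exact le_top
  by_cases hp : ∃ x, φ x ≠ ⊤
  swap
  · push Not at hp
    refine absurd ?_ htop
    simp [eintegral, hp]
  obtain ⟨ψ, hmono, hconv, hlip, hsup⟩ := hc.exists_monotone_lipschitz hl hp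
  have hint : ∀ n, Integrable (ψ n) μ := fun n =>
    let ⟨_, hK⟩ := hlip n
    integrable_of_lipschitzWith hμ hK
  have hint' : ∀ n, Integrable (ψ n) ν := fun n =>
    let ⟨_, hK⟩ := hlip n
    integrable_of_lipschitzWith hν hK
  have hle : ∀ n x, (ψ n x : EReal) ≤ φ x := fun n x => by
    rw [← hsup x]
    exact le_iSup (fun n => (ψ n x : EReal)) n
  have hm := hl.measurable
  obtain ⟨hF, hae⟩ := integrable_toReal_of_eintegral_ne_top hm.aemeasurable (hint' 0) (hle 0) htop
  rw [eintegral_congr_ae hae, eintegral_coe hF]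
  set r := ∫ x, (φ x).toReal ∂ν
  have hr : ∀ n, ∫ x, ψ n x ∂μ ≤ r := fun n => by
    refine (h _ (hconv n) (hlip n)).trans (integral_mono_ae (hint' n) hF ?_)
    filter_upwards [hae] with x hx
    have := hle n x
    rw [hx] at this
    exact_mod_cast this
  -- Monotone convergence is applied to the nonnegative excess over ψ 0.
  have hD : ∫⁻ x, (φ x - ψ 0 x).toENNReal ∂μ ≤ ENNReal.ofReal (r - ∫ x, ψ 0 x ∂μ) := by
    have hlim : Filter.Tendsto (fun n => ∫⁻ x, ENNReal.ofReal (ψ n x - ψ 0 x) ∂μ) Filter.atTop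
        (nhds (∫⁻ x, (φ x - ψ 0 x).toENNReal ∂μ)) := by
      refine lintegral_tendsto_of_tendsto_of_monotone (fun n => ?_) ?_ ?_
      · exact ((hint n).sub (hint 0)).aestronglyMeasurable.aemeasurable.ennreal_ofReal
      · exact Filter.Eventually.of_forall fun x i j hij =>
          ENNReal.ofReal_le_ofReal (sub_le_sub_right (hmono hij x) _)
      · refine Filter.Eventually.of_forall fun x => ?_
        have h1 : Filter.Tendsto (fun n => (ψ n x : EReal)) Filter.atTop (nhds (φ x)) := by
          rw [← hsup x]
          exact tendsto_atTop_iSup fun i j hij => EReal.coe_le_coe_iff.2 (hmono hij x)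
        have h2 : Filter.Tendsto (fun n => (ψ n x : EReal) + ((-ψ 0 x : ℝ) : EReal))
            Filter.atTop (nhds (φ x + ((-ψ 0 x : ℝ) : EReal))) :=
          (EReal.continuousAt_add (p := (φ x, ((-ψ 0 x : ℝ) : EReal)))
            (Or.inr (EReal.coe_ne_bot _)) (Or.inr (EReal.coe_ne_top _))).tendsto.comp
            (h1.prodMk_nhds tendsto_const_nhds)
        have h3 := (EReal.continuous_toENNReal.tendsto _).comp h2
        rw [EReal.coe_neg, ← sub_eq_add_neg] at h3
        refine h3.congr fun n => ?_
        simp only [Function.comp]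
        rw [← sub_eq_add_neg, ← EReal.coe_sub, EReal.real_coe_toENNReal]
    refine le_of_tendsto' hlim fun n => ?_
    rw [← ofReal_integral_eq_lintegral_ofReal (f := fun x => ψ n x - ψ 0 x) ((hint n).sub (hint 0))
      (Filter.Eventually.of_forall fun x => sub_nonneg.2 (hmono (Nat.zero_le n) x)),
      integral_sub (hint n) (hint 0)]
    exact ENNReal.ofReal_le_ofReal (sub_le_sub_right (hr n) _)
  rw [eintegral_eq_lintegral_sub_add hm.aemeasurable (hint 0) (hle 0)]
  refine (add_le_add_left (EReal.coe_ennreal_le_coe_ennreal_iff.2 hD) _).trans ?_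
  rw [EReal.coe_ennreal_ofReal, max_eq_left (sub_nonneg.2 (hr 0)), ← EReal.coe_add]
  simp

end ConvexOrder

/-! ### Integrability, and the objective in terms of P and X -/

section Duality

variable {d : ℕ} {t : ℝ}

theorem integrable_quadratic {ν : Measure (EuclideanSpace ℝ (Fin d))} (hν : MemLp (fun x => x) 2 ν)
    (m : ℝ) :
    Integrable (fun x : EuclideanSpace ℝ (Fin d) => m * (‖x‖ ^ 2 / 2)) ν :=
  (((memLp_two_iff_integrable_sq_norm hν.1).1 hν).div_const 2).const_mul m

theorem integrable_inner_of_memLp {α : Type*} [MeasurableSpace α] {ν : Measure α}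
    {X Y : α → EuclideanSpace ℝ (Fin d)}
    (hX : MemLp X 2 ν) (hY : MemLp Y 2 ν) : Integrable (fun a => inner ℝ (X a) (Y a)) ν := by
  refine Integrable.mono' (g := fun a => ‖X a‖ ^ 2 + ‖Y a‖ ^ 2)
    (((memLp_two_iff_integrable_sq_norm hX.1).1 hX).add
      ((memLp_two_iff_integrable_sq_norm hY.1).1 hY)) (hX.1.inner hY.1)
    (Filter.Eventually.of_forall fun a => ?_)
  refine (norm_inner_le_norm _ _).trans ?_
  nlinarith [sq_nonneg (‖X a‖ - ‖Y a‖), sq_nonneg ‖X a‖, sq_nonneg ‖Y a‖]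

theorem memLp_of_lipschitzWith {ν : Measure (EuclideanSpace ℝ (Fin d))} [IsFiniteMeasure ν]
    (hν : MemLp (fun x => x) 2 ν) {X : EuclideanSpace ℝ (Fin d) → EuclideanSpace ℝ (Fin d)}
    {K : NNReal} (hX : LipschitzWith K X) :
    MemLp X 2 ν := by
  have h1 : MemLp (fun y : EuclideanSpace ℝ (Fin d) => ‖y‖) 2 ν := hν.norm
  have h2 : MemLp (fun _ : EuclideanSpace ℝ (Fin d) => ‖X 0‖) 2 ν := memLp_const _
  refine MemLp.mono' (h2.add (h1.const_mul (K : ℝ))) hX.continuous.aestronglyMeasurable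
    (Filter.Eventually.of_forall fun y => ?_)
  have h := hX.dist_le_mul y 0
  rw [dist_eq_norm, dist_zero_right] at h
  have := norm_le_norm_add_norm_sub (X 0) (X y)
  have := norm_sub_rev (X 0) (X y)
  simp only [Pi.add_apply]
  linarith

namespace IsConjugate

variable {u : EuclideanSpace ℝ (Fin d) → EReal} {P : EuclideanSpace ℝ (Fin d) → ℝ}
    {X : EuclideanSpace ℝ (Fin d) → EuclideanSpace ℝ (Fin d)}

theorem le_quadratic (h : IsConjugate t u P X) (ht : 1 < t) (y z : EuclideanSpace ℝ (Fin d)) :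
    ((inner ℝ z y - P y : ℝ) : EReal) ≤ u z := by
  refine le_trans (EReal.coe_le_coe_iff.2 ?_) (h.le_apply y z)
  have := sub_one_div_pos ht
  have : 0 ≤ (t - 1) / t / 2 * ‖z - X y‖ ^ 2 := by positivity
  linarith

theorem continuous (h : IsConjugate t u P X) : Continuous P :=
  continuous_iff_continuousAt.2 fun y => (h.hasGradientAt y).continuousAt

theorem integrable (h : IsConjugate t u P X) {ν : Measure (EuclideanSpace ℝ (Fin d))}
    [IsFiniteMeasure ν]
    (hν : MemLp (fun x => x) 2 ν) : Integrable P ν := by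
  have h1 : Integrable (fun z => P z - P 0 - inner ℝ (X 0) (z - 0)) ν := by
    refine Integrable.mono' (g := fun z : EuclideanSpace ℝ (Fin d) => t / (t - 1) * (‖z‖ ^ 2 / 2))
      (integrable_quadratic hν _) ?_ (Filter.Eventually.of_forall fun z => ?_)
    · have := h.continuous
      exact Continuous.aestronglyMeasurable (by fun_prop)
    · have := h.abs_le 0 z
      rw [Real.norm_eq_abs]
      rw [sub_zero z] at this ⊢
      linarith
  have h2 : Integrable (fun z : EuclideanSpace ℝ (Fin d) => inner ℝ (X 0) z) ν :=
    integrable_inner_of_memLp (memLp_const _) hν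
  refine ((h1.add h2).add (integrable_const (P 0))).congr
    (Filter.Eventually.of_forall fun z => ?_)
  simp

theorem dualObjective_eq (h : IsConjugate t u P X) {ν₀ ν₁ : Measure (EuclideanSpace ℝ (Fin d))}
    [IsFiniteMeasure ν₁]
    (hν₁ : MemLp (fun x => x) 2 ν₁) :
    dualObjective ν₀ ν₁ u = ((∫ y, P y ∂ν₁ : ℝ) : EReal) + eintegral u ν₀ := by
  unfold dualObjective
  rw [show legendre u = fun y => (P y : EReal) from funext h.legendre_eq,
    eintegral_coe (h.integrable hν₁)]

/-- The value of `u - (t - 1) / t |·|² / 2` along the gradient of the Legendre transform. -/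
theorem subQuadratic_apply (h : IsConjugate t u P X) (y : EuclideanSpace ℝ (Fin d)) :
    subQuadratic ((t - 1) / t) u (X y) =
      ((inner ℝ (X y) y - P y - (t - 1) / t * (‖X y‖ ^ 2 / 2) : ℝ) : EReal) :=
  subQuadratic_of_eq_coe (h.apply_eq y)

theorem integrable_subQuadratic (h : IsConjugate t u P X) {ν₁ : Measure (EuclideanSpace ℝ (Fin d))}
    [IsFiniteMeasure ν₁]
    (hν₁ : MemLp (fun x => x) 2 ν₁) :
    Integrable (fun y => inner ℝ (X y) y - P y - (t - 1) / t * (‖X y‖ ^ 2 / 2)) ν₁ := by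
  have hX := memLp_of_lipschitzWith hν₁ h.lipschitz
  exact ((integrable_inner_of_memLp hX hν₁).sub (h.integrable hν₁)).sub
    ((((memLp_two_iff_integrable_sq_norm hX.1).1 hX).div_const 2).const_mul _)

theorem eintegral_subQuadratic_map (h : IsConjugate t u P X) (hu : IsAdmissible t u)
    {ν₁ : Measure (EuclideanSpace ℝ (Fin d))} [IsFiniteMeasure ν₁] (hν₁ : MemLp (fun x => x) 2 ν₁) :
    eintegral (subQuadratic ((t - 1) / t) u) (ν₁.map X) =
      ((∫ y, (inner ℝ (X y) y - P y - (t - 1) / t * (‖X y‖ ^ 2 / 2)) ∂ν₁ : ℝ) : EReal) := by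
  rw [eintegral_map h.lipschitz.continuous.measurable
    (lowerSemicontinuous_subQuadratic hu.lowerSemicontinuous).measurable]
  simp only [h.subQuadratic_apply]
  exact eintegral_coe (h.integrable_subQuadratic hν₁)

end IsConjugate

theorem exists_integrable_of_eintegral_ne_top {u : EuclideanSpace ℝ (Fin d) → EReal}
    {P : EuclideanSpace ℝ (Fin d) → ℝ} {X : EuclideanSpace ℝ (Fin d) → EuclideanSpace ℝ (Fin d)}
    (ht : 1 < t) (h : IsConjugate t u P X) (hu : IsAdmissible t u)
    {ν₀ : Measure (EuclideanSpace ℝ (Fin d))}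
    [IsFiniteMeasure ν₀] (hfin : eintegral u ν₀ ≠ ⊤) :
    ∃ U : EuclideanSpace ℝ (Fin d) → ℝ, Integrable U ν₀ ∧ u =ᵐ[ν₀] fun x => (U x : EReal) :=
  ⟨_, integrable_toReal_of_eintegral_ne_top (l := fun _ => -P 0)
    hu.lowerSemicontinuous.measurable.aemeasurable (integrable_const _)
    (fun x => by simpa using h.le_quadratic ht 0 x) hfin⟩

theorem eintegral_subQuadratic_of_ae {u : EuclideanSpace ℝ (Fin d) → EReal}
    {U : EuclideanSpace ℝ (Fin d) → ℝ} {ν₀ : Measure (EuclideanSpace ℝ (Fin d))}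
    (hν₀ : MemLp (fun x => x) 2 ν₀) (hU : Integrable U ν₀)
    (hae : u =ᵐ[ν₀] fun x => (U x : EReal)) (m : ℝ) :
    eintegral (subQuadratic m u) ν₀ =
      ((∫ x, U x ∂ν₀ - ∫ x, m * (‖x‖ ^ 2 / 2) ∂ν₀ : ℝ) : EReal) := by
  have h1 : subQuadratic m u =ᵐ[ν₀] fun x => ((U x - m * (‖x‖ ^ 2 / 2) : ℝ) : EReal) :=
    hae.mono fun x hx => subQuadratic_of_eq_coe hx
  have hQ := integrable_quadratic hν₀ m
  rw [eintegral_congr_ae h1, eintegral_coe (F := fun x => U x - m * (‖x‖ ^ 2 / 2)) (hU.sub hQ),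
    integral_sub hU hQ]

/-! ### Optimality conditions: necessity and sufficiency -/

section Main

variable {ν₀ ν₁ : Measure (EuclideanSpace ℝ (Fin d))} [IsProbabilityMeasure ν₁]
  {u : EuclideanSpace ℝ (Fin d) → EReal} {P : EuclideanSpace ℝ (Fin d) → ℝ}
    {X : EuclideanSpace ℝ (Fin d) → EuclideanSpace ℝ (Fin d)}

/-- The competitor m|·|²/2 has a finite objective because the second moments are finite. -/
theorem SolvesDual.eintegral_ne_top (ht : 1 < t) (hν₀ : MemLp (fun x => x) 2 ν₀)
    (hν₁ : MemLp (fun x => x) 2 ν₁) (h : IsConjugate t u P X) (hs : SolvesDual t ν₀ ν₁ u) :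
    eintegral u ν₀ ≠ ⊤ := by
  intro htop
  have hv : IsAdmissible t fun x : EuclideanSpace ℝ (Fin d) =>
      ((0 : ℝ) : EReal) + (((t - 1) / t * (‖x‖ ^ 2 / 2) : ℝ) : EReal) :=
    isAdmissible_add_quadratic (isConvex_coe (convexOn_const 0 convex_univ))
      continuous_const.lowerSemicontinuous ⟨0, by simp⟩
  obtain ⟨P', X', h'⟩ := hv.exists_isConjugate ht
  have hle := hs.2 _ hv
  rw [h.dualObjective_eq hν₁, h'.dualObjective_eq hν₁, htop] at hle
  simp only [← EReal.coe_add, zero_add] at hle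
  rw [eintegral_coe (integrable_quadratic hν₀ _), ← EReal.coe_add,
    EReal.coe_add_top, top_le_iff] at hle
  exact EReal.coe_ne_top _ hle

/-- Optimality of `u` against an admissible competitor with given integral and given bound on
its Legendre transform. -/
theorem SolvesDual.integral_le (ht : 1 < t) (hν₁ : MemLp (fun x => x) 2 ν₁)
    (h : IsConjugate t u P X) (hs : SolvesDual t ν₀ ν₁ u) {U : EuclideanSpace ℝ (Fin d) → ℝ}
    (hU : Integrable U ν₀)
    (hae : u =ᵐ[ν₀] fun x => (U x : EReal)) {v : EuclideanSpace ℝ (Fin d) → EReal}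
    (hv : IsAdmissible t v) {V : EuclideanSpace ℝ (Fin d) → ℝ}
    (hV : Integrable V ν₀) (hvae : v =ᵐ[ν₀] fun x => (V x : EReal))
    {B : EuclideanSpace ℝ (Fin d) → ℝ}
    (hB : Integrable B ν₁) (hvB : ∀ y x (r : ℝ), v x = r → inner ℝ x y - r ≤ B y) :
    ∫ y, P y ∂ν₁ + ∫ x, U x ∂ν₀ ≤ ∫ y, B y ∂ν₁ + ∫ x, V x ∂ν₀ := by
  obtain ⟨P', X', h'⟩ := hv.exists_isConjugate ht
  have hle := hs.2 v hv
  rw [h.dualObjective_eq hν₁, h'.dualObjective_eq hν₁, eintegral_congr_ae hae,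
    eintegral_congr_ae hvae, eintegral_coe hU, eintegral_coe hV, ← EReal.coe_add,
    ← EReal.coe_add, EReal.coe_le_coe_iff] at hle
  have h1 : ∫ y, P' y ∂ν₁ ≤ ∫ y, B y ∂ν₁ := by
    refine integral_mono (h'.integrable hν₁) hB fun y => ?_
    rw [← EReal.coe_le_coe_iff, ← h'.legendre_eq]
    exact (legendre_le_iff hv.ne_bot).2 (hvB y)
  linarith

/-- First-order optimality in the direction of a Lipschitz convex function. -/
theorem SolvesDual.integral_comp_le [IsProbabilityMeasure ν₀] (ht : 1 < t)
    (hν₀ : MemLp (fun x => x) 2 ν₀)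
    (hν₁ : MemLp (fun x => x) 2 ν₁) (h : IsConjugate t u P X) (hs : SolvesDual t ν₀ ν₁ u)
    {φ : EuclideanSpace ℝ (Fin d) → ℝ} (hφ : ConvexOn ℝ Set.univ φ) {K : NNReal}
    (hK : LipschitzWith K φ) :
    ∫ y, φ (X y) ∂ν₁ ≤ ∫ x, φ x ∂ν₀ := by
  obtain ⟨U, hU, hae⟩ := exists_integrable_of_eintegral_ne_top ht h hs.1
    (hs.eintegral_ne_top ht hν₀ hν₁ h)
  set m := (t - 1) / t
  have hm0 : 0 < m := sub_one_div_pos ht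
  have hφi : Integrable φ ν₀ := integrable_of_lipschitzWith (hν₀.integrable one_le_two) hK
  have hφX : Integrable (fun y => φ (X y)) ν₁ :=
    integrable_of_lipschitzWith (hν₁.integrable one_le_two) (hK.comp h.lipschitz)
  rw [← sub_nonpos]
  refine nonpos_of_forall_le_mul (B := K ^ 2 / (2 * m)) fun ε hε0 _ => ?_
  have hPφ : Integrable (fun y => P y - ε * φ (X y)) ν₁ :=
    (h.integrable hν₁).sub (hφX.const_mul ε)
  have hv : IsAdmissible t fun x => u x + ((ε * φ x : ℝ) : EReal) := by
    have h1 := isAdmissible_add_quadratic (t := t)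
      (hs.1.convex.add_convexOn (hφ.smul hε0.le))
      (LowerSemicontinuous.add_coe (lowerSemicontinuous_subQuadratic hs.1.lowerSemicontinuous)
        (continuous_const.mul hK.continuous))
      (by
        obtain ⟨x, hx⟩ := hs.1.subQuadratic_proper m
        exact ⟨x, EReal.add_ne_top hx (EReal.coe_ne_top _)⟩)
    convert h1 using 2 with x
    rw [add_right_comm, ← eq_subQuadratic_add]
    rfl
  have key := hs.integral_le ht hν₁ h hU hae hv (V := fun x => U x + ε * φ x)
    (hU.add (hφi.const_mul ε)) (hae.mono fun x hx => by simp only [hx]; rw [← EReal.coe_add])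
    -- With ρ = ‖x - X y‖, the perturbation gains at most εKρ over its value at X y while the growth
    -- of u costs mρ²/2; the maximum of the difference is ε²K²/(2m).
    (B := fun y => P y - ε * φ (X y) + ε ^ 2 * (K ^ 2 / (2 * m)))
    (hPφ.add (integrable_const _)) fun y x r hr => ?_
  · rw [integral_add hU (hφi.const_mul ε),
      integral_add hPφ (integrable_const _),
      integral_sub (h.integrable hν₁) (hφX.const_mul ε)] at key
    simp only [integral_const_mul, integral_const, probReal_univ, one_smul] at key
    refine le_of_mul_le_mul_left (a := ε) ?_ hε0
    linarith
  · have hux : u x = ((r - ε * φ x : ℝ) : EReal) := by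
      rw [EReal.coe_sub, ← hr, EReal.add_sub_cancel_right]
    have h1 := h.le_apply y x
    rw [hux, EReal.coe_le_coe_iff] at h1
    have h2 : φ (X y) - φ x ≤ K * ‖x - X y‖ := by
      have := hK.dist_le_mul x (X y)
      rw [Real.dist_eq, dist_eq_norm] at this
      linarith [neg_abs_le (φ x - φ (X y))]
    have h3 : ε * (φ (X y) - φ x) ≤ ε * (K * ‖x - X y‖) := mul_le_mul_of_nonneg_left h2 hε0.le
    have h4 : m / 2 * ‖x - X y‖ ^ 2 - ε * (K * ‖x - X y‖) + ε ^ 2 * (K ^ 2 / (2 * m)) =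
        1 / (2 * m) * (m * ‖x - X y‖ - ε * K) ^ 2 := by
      field_simp
      ring
    have h5 : 0 ≤ 1 / (2 * m) * (m * ‖x - X y‖ - ε * K) ^ 2 := by positivity
    linarith

/-- First-order optimality in the direction of minus the convex part of `u`. -/
theorem SolvesDual.eintegral_subQuadratic_le [IsProbabilityMeasure ν₀] (ht : 1 < t)
    (hν₀ : MemLp (fun x => x) 2 ν₀)
    (hν₁ : MemLp (fun x => x) 2 ν₁) (h : IsConjugate t u P X) (hs : SolvesDual t ν₀ ν₁ u) :
    eintegral (subQuadratic ((t - 1) / t) u) ν₀ ≤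
      eintegral (subQuadratic ((t - 1) / t) u) (ν₁.map X) := by
  obtain ⟨U, hU, hae⟩ := exists_integrable_of_eintegral_ne_top ht h hs.1
    (hs.eintegral_ne_top ht hν₀ hν₁ h)
  rw [h.eintegral_subQuadratic_map hs.1 hν₁, eintegral_subQuadratic_of_ae hν₀ hU hae,
    EReal.coe_le_coe_iff]
  have hGX := h.integrable_subQuadratic hν₁
  have hX := memLp_of_lipschitzWith hν₁ h.lipschitz
  have hsq : Integrable (fun y => ‖y - ((t - 1) / t) • X y‖ ^ 2) ν₁ := by
    have : MemLp (fun y => y - ((t - 1) / t) • X y) 2 ν₁ := 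
      hν₁.sub (hX.const_smul ((t - 1) / t))
    exact (memLp_two_iff_integrable_sq_norm this.1).1 this
  set m := (t - 1) / t
  have hm0 : 0 < m := sub_one_div_pos ht
  have hQ := integrable_quadratic hν₀ m
  rw [← sub_nonpos]
  refine nonpos_of_forall_le_mul (B := (∫ y, ‖y - m • X y‖ ^ 2 ∂ν₁) / (2 * m))
    fun τ hτ0 hτ1 => ?_
  -- With this scaling, τB is the integrated second-order error ε²‖y - m X y‖²/m divided by ε.
  obtain ⟨ε, rfl⟩ : ∃ ε, τ = 2 * ε := ⟨τ / 2, by ring⟩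
  have hε0 : 0 < ε := by linarith
  have hε1 : 0 < 1 - ε := by linarith
  have hUQ : Integrable (fun x => (1 - ε) * (U x - m * (‖x‖ ^ 2 / 2))) ν₀ :=
    (hU.sub hQ).const_mul _
  have hPG : Integrable (fun y => P y + ε * (inner ℝ (X y) y - P y - m * (‖X y‖ ^ 2 / 2))) ν₁ :=
    (h.integrable hν₁).add (hGX.const_mul ε)
  have hsq' : Integrable (fun y => ε ^ 2 * (‖y - m • X y‖ ^ 2 / m)) ν₁ :=
    (hsq.div_const m).const_mul _
  -- Where u is finite, the competitor equals (1 - ε)u + εm|·|²/2, so lower bounds on u suffice.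
  -- Expanding the quadratic at X y restores the full curvature m/2, of which half absorbs the
  -- linear term with slope ε(y - m X y).
  have hv : IsAdmissible t fun x => ((1 - ε : ℝ) : EReal) * subQuadratic m u x +
      ((m * (‖x‖ ^ 2 / 2) : ℝ) : EReal) := by
    refine isAdmissible_add_quadratic (hs.1.convex.coe_mul hε1) ?_ ?_
    · exact (continuous_coe_mul hε1.ne').comp_lowerSemicontinuous
        (lowerSemicontinuous_subQuadratic hs.1.lowerSemicontinuous)
        fun a b hab => mul_le_mul_of_nonneg_left hab (EReal.coe_nonneg.2 hε1.le)
    · obtain ⟨x, hx⟩ := hs.1.exists_ne_top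
      refine ⟨x, ?_⟩
      rw [subQuadratic_of_eq_coe (EReal.coe_toReal hx (hs.1.ne_bot x)).symm, ← EReal.coe_mul]
      exact EReal.coe_ne_top _
  have key := hs.integral_le ht hν₁ h hU hae hv
    (V := fun x => (1 - ε) * (U x - m * (‖x‖ ^ 2 / 2)) + m * (‖x‖ ^ 2 / 2))
    (hUQ.add hQ)
    (hae.mono fun x hx => by
      simp only [subQuadratic_of_eq_coe hx]
      rw [← EReal.coe_mul, ← EReal.coe_add])
    (B := fun y => P y + ε * (inner ℝ (X y) y - P y - m * (‖X y‖ ^ 2 / 2)) +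
      ε ^ 2 * (‖y - m • X y‖ ^ 2 / m))
    (hPG.add hsq')
    fun y x r hr => ?_
  · rw [integral_add hUQ hQ,
      integral_add hPG hsq',
      integral_add (h.integrable hν₁) (hGX.const_mul ε), integral_const_mul,
      integral_const_mul, integral_const_mul, integral_sub hU hQ, integral_div] at key
    refine le_of_mul_le_mul_left (a := ε) ?_ hε0
    have h1 : ε * (2 * ε * ((∫ y, ‖y - m • X y‖ ^ 2 ∂ν₁) / (2 * m))) =
        ε ^ 2 * ((∫ y, ‖y - m • X y‖ ^ 2 ∂ν₁) / m) := by
      field_simp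
    rw [h1]
    linarith
  · obtain ⟨s, hs'⟩ : ∃ s : ℝ, u x = s := by
      refine ⟨_, (EReal.coe_toReal (fun hx => ?_) (hs.1.ne_bot x)).symm⟩
      have hx' : subQuadratic m u x = ⊤ := by
        unfold subQuadratic
        rw [hx, EReal.top_sub_coe]
      rw [hx', EReal.coe_mul_top_of_pos hε1, EReal.top_add_coe] at hr
      exact EReal.coe_ne_top _ hr.symm
    rw [subQuadratic_of_eq_coe hs', ← EReal.coe_mul, ← EReal.coe_add,
      EReal.coe_eq_coe_iff] at hr
    have h1 := h.le_apply y x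
    rw [hs', EReal.coe_le_coe_iff] at h1
    have h2 : (1 - ε) * (inner ℝ x y - P y + m / 2 * ‖x - X y‖ ^ 2) ≤ (1 - ε) * s :=
      mul_le_mul_of_nonneg_left h1 hε1.le
    have h3 : m * (‖x‖ ^ 2 / 2) = m * (‖X y‖ ^ 2 / 2) + m * inner ℝ (X y) (x - X y) +
        m / 2 * ‖x - X y‖ ^ 2 := by
      have : ‖x‖ ^ 2 = ‖X y + (x - X y)‖ ^ 2 := by rw [add_sub_cancel]
      rw [this, norm_add_sq_real]
      ring
    have h4 : inner ℝ x y - inner ℝ (X y) y - m * inner ℝ (X y) (x - X y) ≤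
        ‖y - m • X y‖ * ‖x - X y‖ := by
      refine le_trans (le_of_eq ?_) (real_inner_le_norm _ _)
      rw [inner_sub_left, real_inner_smul_left, inner_sub_right y, real_inner_comm y x,
        real_inner_comm y (X y)]
    have h5 : ε * (inner ℝ x y - inner ℝ (X y) y - m * inner ℝ (X y) (x - X y)) ≤
        ε * (‖y - m • X y‖ * ‖x - X y‖) := mul_le_mul_of_nonneg_left h4 hε0.le
    have h6 : m / 4 * ‖x - X y‖ ^ 2 - ε * (‖y - m • X y‖ * ‖x - X y‖) +
        ε ^ 2 * (‖y - m • X y‖ ^ 2 / m) =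
        1 / m * (m / 2 * ‖x - X y‖ - ε * ‖y - m • X y‖) ^ 2 := by
      field_simp
      ring
    have h7 : 0 ≤ 1 / m * (m / 2 * ‖x - X y‖ - ε * ‖y - m • X y‖) ^ 2 := by positivity
    have h8 : m / 4 * ‖x - X y‖ ^ 2 ≤ m / 2 * ‖x - X y‖ ^ 2 := by
      have : 0 ≤ m * ‖x - X y‖ ^ 2 := by positivity
      linarith
    have h9 : ε * (m * (‖x‖ ^ 2 / 2)) = ε * (m * (‖X y‖ ^ 2 / 2)) +
        ε * (m * inner ℝ (X y) (x - X y)) + ε * (m / 2 * ‖x - X y‖ ^ 2) := by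
      rw [h3]; ring
    subst hr
    generalize ‖x - X y‖ ^ 2 = D at *
    generalize m * (‖x‖ ^ 2 / 2) = q at *
    generalize m * (‖X y‖ ^ 2 / 2) = q' at *
    linarith

theorem IsConjugate.memLp_map (h : IsConjugate t u P X) (hν₁ : MemLp (fun x => x) 2 ν₁) :
    MemLp (fun x => x) 2 (ν₁.map X) := by
  have hX : AEMeasurable X ν₁ := h.lipschitz.continuous.measurable.aemeasurable
  exact (memLp_map_measure_iff aestronglyMeasurable_id hX).2
    (memLp_of_lipschitzWith hν₁ h.lipschitz)

theorem SolvesDual.eintegral_map_le [IsProbabilityMeasure ν₀] (ht : 1 < t)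
    (hν₀ : MemLp (fun x => x) 2 ν₀)
    (hν₁ : MemLp (fun x => x) 2 ν₁) (h : IsConjugate t u P X) (hs : SolvesDual t ν₀ ν₁ u)
    {φ : EuclideanSpace ℝ (Fin d) → EReal} (hl : LowerSemicontinuous φ) (hc : IsConvex φ) :
    eintegral φ (ν₁.map X) ≤ eintegral φ ν₀ := by
  have hX : AEMeasurable X ν₁ := h.lipschitz.continuous.measurable.aemeasurable
  have := Measure.isProbabilityMeasure_map hX
  refine eintegral_le_of_lipschitz ((h.memLp_map hν₁).integrable one_le_two)
    (hν₀.integrable one_le_two) (fun ψ hψ ⟨K, hK⟩ => ?_) hl hc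
  rw [integral_map hX hK.continuous.aestronglyMeasurable]
  exact hs.integral_comp_le ht hν₀ hν₁ h hψ hK

theorem solvesDual_of_eintegral_le [IsProbabilityMeasure ν₀] (ht : 1 < t)
    (hν₀ : MemLp (fun x => x) 2 ν₀)
    (hν₁ : MemLp (fun x => x) 2 ν₁) (h : IsConjugate t u P X) (hu : IsAdmissible t u)
    (heq : eintegral (subQuadratic ((t - 1) / t) u) (ν₁.map X) =
      eintegral (subQuadratic ((t - 1) / t) u) ν₀)
    (hle : ∀ φ : EuclideanSpace ℝ (Fin d) → EReal, LowerSemicontinuous φ → IsConvex φ →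
      eintegral φ (ν₁.map X) ≤ eintegral φ ν₀) :
    SolvesDual t ν₀ ν₁ u := by
  refine ⟨hu, fun v hv => ?_⟩
  obtain ⟨P', X', h'⟩ := hv.exists_isConjugate ht
  rw [h.dualObjective_eq hν₁, h'.dualObjective_eq hν₁]
  by_cases hvtop : eintegral v ν₀ = ⊤
  · rw [hvtop, EReal.coe_add_top]
    exact le_top
  obtain ⟨V, hV, hvae⟩ := exists_integrable_of_eintegral_ne_top ht h' hv hvtop
  rw [h.eintegral_subQuadratic_map hu hν₁] at heq
  have hGX := h.integrable_subQuadratic hν₁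
  have hX := h.lipschitz.continuous.measurable
  have := Measure.isProbabilityMeasure_map (μ := ν₁) hX.aemeasurable
  have hQ := integrable_quadratic hν₀ ((t - 1) / t)
  set m := (t - 1) / t
  -- Fenchel's inequality at y = 0 gives an integrable minorant, which justifies splitting ∫ u dν₀
  -- before it is known to be finite.
  have hlow : ∀ x, ((-P 0 - m * (‖x‖ ^ 2 / 2) : ℝ) : EReal) ≤ subQuadratic m u x := fun x => by
    refine coe_le_of_forall_coe (f := subQuadratic m u)
      (l := fun x => -P 0 - m * (‖x‖ ^ 2 / 2))
      (fun x => subQuadratic_ne_bot (hu.ne_bot x)) (fun z s hz => ?_) x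
    have h1 := h.le_quadratic ht 0 z
    rw [eq_subQuadratic_add m u, hz, ← EReal.coe_add, EReal.coe_le_coe_iff] at h1
    simp only [inner_zero_right] at h1
    linarith
  have hueq : eintegral u ν₀ = eintegral (subQuadratic m u) ν₀ +
      ((∫ x, m * (‖x‖ ^ 2 / 2) ∂ν₀ : ℝ) : EReal) := by
    rw [← eintegral_add_coe
      (lowerSemicontinuous_subQuadratic hu.lowerSemicontinuous).measurable.aemeasurable
      ((integrable_const _).sub hQ) hlow hQ]
    congr 1
    funext x
    exact eq_subQuadratic_add m u x
  have hgv : eintegral (subQuadratic m v) (ν₁.map X) ≤ eintegral (subQuadratic m v) ν₀ :=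
    hle _ (lowerSemicontinuous_subQuadratic hv.lowerSemicontinuous) hv.convex
  rw [eintegral_subQuadratic_of_ae hν₀ hV hvae] at hgv
  rw [hueq, ← heq, eintegral_congr_ae hvae, eintegral_coe hV, ← EReal.coe_add, ← EReal.coe_add,
    ← EReal.coe_add, EReal.coe_le_coe_iff]
  have hvm := (lowerSemicontinuous_subQuadratic (m := m) hv.lowerSemicontinuous).measurable
  rw [eintegral_map hX hvm] at hgv
  -- Fenchel's inequality for v at the pair (X y, y), where u has equality.
  have hcomp : eintegral (fun y => ((inner ℝ (X y) y - P y - m * (‖X y‖ ^ 2 / 2) -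
      (P' y - P y) : ℝ) : EReal)) ν₁ ≤ eintegral (fun y => subQuadratic m v (X y)) ν₁ := by
    refine eintegral_mono fun y => ?_
    refine coe_le_of_forall_coe (f := subQuadratic m v)
      (l := fun x => inner ℝ x y - P' y - m * (‖x‖ ^ 2 / 2))
      (fun x => subQuadratic_ne_bot (hv.ne_bot x)) (fun z s hz => ?_) (X y) |>.trans' ?_
    · have h1 := h'.le_quadratic ht y z
      rw [eq_subQuadratic_add m v, hz, ← EReal.coe_add, EReal.coe_le_coe_iff] at h1
      linarith
    · rw [EReal.coe_le_coe_iff]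
      linarith
  have hP := h.integrable hν₁
  have hP' := h'.integrable hν₁
  have hPP : Integrable (fun y => P' y - P y) ν₁ := hP'.sub hP
  have hfin := hcomp.trans hgv
  rw [eintegral_coe (F := fun y => inner ℝ (X y) y - P y - m * (‖X y‖ ^ 2 / 2) - (P' y - P y))
    (hGX.sub hPP), EReal.coe_le_coe_iff, integral_sub hGX hPP, integral_sub hP' hP] at hfin
  linarith

end Main

end Duality

end Extrapolation

end

theorem mainTheorem3 (d : ℕ) (t : ℝ) (ht : 1 < t)
    (ν₀ ν₁ : Measure (EuclideanSpace ℝ (Fin d)))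
    [IsProbabilityMeasure ν₀] [IsProbabilityMeasure ν₁]
    (hν₀ : MemLp (fun x => x) 2 ν₀) (hν₁ : MemLp (fun x => x) 2 ν₁)
    (u : EuclideanSpace ℝ (Fin d) → EReal) (hu : Extrapolation.IsAdmissible t u) :
    -- `∇u*` is well defined and Lipschitz, so that the push-forward of `ν₁` makes sense
    ((∀ y, ∃ r : ℝ, Extrapolation.legendre u y = (r : EReal)) ∧
      Differentiable ℝ (fun y => (Extrapolation.legendre u y).toReal) ∧
      LipschitzWith (Real.toNNReal (t / (t - 1))) (Extrapolation.gradLegendre u)) ∧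
    -- characterization of the solutions, with `η = (∇u*)_# ν₁ - ν₀`
    (Extrapolation.SolvesDual t ν₀ ν₁ u ↔
      Extrapolation.eintegralDiff (Extrapolation.subQuadratic ((t - 1) / t) u)
          (ν₁.map (Extrapolation.gradLegendre u)) ν₀ = 0 ∧
        ∀ φ : EuclideanSpace ℝ (Fin d) → EReal,
          LowerSemicontinuous φ → Extrapolation.IsConvex φ →
            Extrapolation.eintegralDiff φ (ν₁.map (Extrapolation.gradLegendre u)) ν₀ ≤ 0) ∧
    -- convex order
    (Extrapolation.SolvesDual t ν₀ ν₁ u →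
      Extrapolation.ConvexOrderLE (ν₁.map (Extrapolation.gradLegendre u)) ν₀) := by
  open Extrapolation in
  obtain ⟨P, X, h⟩ := hu.exists_isConjugate ht
  rw [h.gradLegendre_eq, h.toReal_legendre]
  refine ⟨⟨fun y => ⟨_, h.legendre_eq y⟩, fun y => (h.hasGradientAt y).differentiableAt,
    h.lipschitz⟩, ⟨fun hs => ⟨?_, fun φ hl hc => ?_⟩, fun ⟨heq, hle⟩ => ?_⟩, fun hs => ?_⟩
  · rw [eintegralDiff_eq_zero_iff]
    refine ⟨_, h.eintegral_subQuadratic_map hu hν₁, ?_⟩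
    rw [← h.eintegral_subQuadratic_map hu hν₁]
    exact le_antisymm (hs.eintegral_subQuadratic_le ht hν₀ hν₁ h)
      (hs.eintegral_map_le ht hν₀ hν₁ h
        (lowerSemicontinuous_subQuadratic hu.lowerSemicontinuous) hu.convex)
  · rw [eintegralDiff_nonpos_iff]
    exact hs.eintegral_map_le ht hν₀ hν₁ h hl hc
  · obtain ⟨r, h1, h2⟩ := (eintegralDiff_eq_zero_iff _ _ _).1 heq
    exact solvesDual_of_eintegral_le ht hν₀ hν₁ h hu (h1.trans h2.symm) fun φ hl hc =>
      (eintegralDiff_nonpos_iff _ _ _).1 (hle φ hl hc)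
  · exact
      { isProbabilityMeasure_left :=
          Measure.isProbabilityMeasure_map h.lipschitz.continuous.measurable.aemeasurable
        isProbabilityMeasure_right := inferInstance
        integrable_left := (h.memLp_map hν₁).integrable one_le_two
        integrable_right := hν₀.integrable one_le_two
        le := fun φ hφ => hs.eintegral_map_le ht hν₀ hν₁ h
          (continuous_coe_real_ereal.comp
            (continuousOn_univ.1 (hφ.continuousOn isOpen_univ))).lowerSemicontinuous
          (isConvex_coe hφ) }
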